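/- Let $\mathfrak g$ be a finite-dimensional complex simple Lie algebra, $\mathfrak h$ a Cartan subalgebra, $\ell=\dim\mathfrak h$ the rank of $\mathfrak g$, $\Delta\subset\mathfrak h^*$ the set of roots, and $\Pi=\{\alpha_i\mid i\in I\}$ a set of simple roots, so that $|I|=\ell$. Let $h$ be the Coxeter number of $\mathfrak g$, that is, the integer with $\dim\mathfrak g=\ell(h+1)$. Let $I=I_1\sqcup I_2$ be a partition such that, for $k=1,2$, the roots $\alpha_i$ and $\alpha_j$ are orthogonal whenever $i,j\in I_k$ and $i\ne j$. Let $s_i$ be the reflection of $\mathfrak h^*$ defined by $\alpha_i$, let $\tau_k=\prod_{i\in I_k}s_i$ (a product of commuting reflections) for $k=1,2$, let $\sigma=\tau_2\tau_1$ be the bipartite Coxeter element, and let $Z$ be the cyclic group generated by $\sigma$. Put $\beta_i=\alpha_i$ if $i\in I_1$ and $\beta_i=-\alpha_i$ if $i\in I_2$. Then for every $i\in I$ the $\sigma$-orbit $Z\cdot\beta_i$ has exactly $h$ elements, and $\Delta$ is the disjoint union of the $\ell$ orbits: $$\Delta=\bigsqcup_{i\in I} Z\cdot\beta_i .$$ 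-/

import Mathlib

/-- The Coxeter number `h` of a simple Lie algebra `𝔤` of rank `ℓ = dim H` (with `H` a Cartan
subalgebra): the natural number determined by `dim 𝔤 = ℓ (h + 1)`. -/
noncomputable def LieAlgebra.coxeterNumber {𝔤 : Type*} [LieRing 𝔤] [LieAlgebra ℂ 𝔤]
    (H : LieSubalgebra ℂ 𝔤) : ℕ :=
  Module.finrank ℂ 𝔤 / Module.finrank ℂ H - 1

namespace RootPairing.Base

variable {ι R M N : Type*} [CommRing R] [AddCommGroup M] [Module R M] [AddCommGroup N] [Module R N]
  {P : RootPairing ι R M N}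

/-- A partition `I = I₁ ⊔ I₂` of the index set of the simple roots such that any two different
simple roots in the same part are orthogonal. -/
structure OrthogonalBipartition [DecidableEq ι] (b : P.Base) where
  I₁ : Finset ι
  I₂ : Finset ι
  disjoint : Disjoint I₁ I₂
  union_eq : I₁ ∪ I₂ = b.support
  orthogonal₁ : (I₁ : Set ι).Pairwise P.IsOrthogonal
  orthogonal₂ : (I₂ : Set ι).Pairwise P.IsOrthogonal

namespace OrthogonalBipartition

variable [DecidableEq ι] {b : P.Base} (c : b.OrthogonalBipartition)

/-- The product of the (commuting) simple reflections `s_i` with `i ∈ I₁`. -/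
def τ₁ : M ≃ₗ[R] M :=
  c.I₁.noncommProd P.reflection fun _ hi _ hj hij ↦
    P.isOrthogonal_comm _ _ (c.orthogonal₁ hi hj hij)

/-- The product of the (commuting) simple reflections `s_i` with `i ∈ I₂`. -/
def τ₂ : M ≃ₗ[R] M :=
  c.I₂.noncommProd P.reflection fun _ hi _ hj hij ↦
    P.isOrthogonal_comm _ _ (c.orthogonal₂ hi hj hij)

/-- The bipartite Coxeter element `σ = τ₂ τ₁` (first `τ₁`, then `τ₂`). -/
def σ : M ≃ₗ[R] M := c.τ₂ * c.τ₁

/-- The modified simple roots: `β_i = α_i` for `i ∈ I₁`, and `β_i = -α_i` for `i ∈ I₂`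
(only used for `i ∈ I₁ ∪ I₂`). -/
def β (i : ι) : M := if i ∈ c.I₁ then P.root i else -P.root i

/-- The orbit `Z · β_i`, where `Z` is the cyclic group generated by `σ`. -/
def orbit (i : ι) : Set M := MulAction.orbit (Subgroup.zpowers c.σ) (c.β i)

end OrthogonalBipartition

end RootPairing.Base

/-!
The proof works in an irreducible reduced crystallographic root system and follows the projection
of the roots to the Coxeter plane, expressed without any geometry. Let `A` be the Cartan matrix. By
Perron–Frobenius there are positive weights `p` on the simple roots with `(2 - A) p = μ p`
(`nonempty_perronVector`). For a vector `v`, let `g₁ v` and `g₂ v` be the sums of its coordinates at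
`I₁` and at `I₂`, weighted by `p`. Then `τ₁` maps `(g₁, g₂)` to `(μ g₂ - g₁, g₂)`, and `τ₂` maps it
to `(g₁, μ g₁ - g₂)`. Hence along the orbit of each `β i` the weights are, up to the sign and the
factor `p i`, given by one and the same sequence, namely `y 0 = 0`, `y 1 = 1`,
`y (m + 2) = μ y (m + 1) - y m` (`coxeterSeq`).

The weights of a root have the same sign, and a positive root with `g₂ = 0` is a simple root in
`I₁`, since simple roots in `I₁` are orthogonal. As there are finitely many roots, `y` returns to
zero; let `n` be the first positive index at which it does. Then `y` is positive on `(0, n)` and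
`y (n + k)` is a negative multiple of `y k`. Three consequences:

* `σ ^ n` maps simple roots to positive roots, hence is trivial, by the deletion argument for words
  in the simple reflections (`prod_reflection_eq_one`);
* `σ ^ k (β i) = β j` forces `n ∣ k` (`dvd_of_σ_pow_β_eq`), so that the orbits have exactly `n`
  elements and are pairwise disjoint;
* every orbit of roots has a positive member followed by a negative one, and at such a place it
  contains some `β i` (`exists_σ_pow_eq_β`), so that the orbits exhaust the roots.

Thus the number of roots is `ℓ n`. By the root space decomposition it is also `dim 𝔤 - ℓ`, which
identifies `n` with the Coxeter number.
-/

/-! ### Products of simple reflections -/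

namespace RootPairing.Base

variable {ι R M N : Type*} [CommRing R] [CharZero R] [AddCommGroup M] [Module R M] [AddCommGroup N]
  [Module R N] {P : RootPairing ι R M N} (b : P.Base)

/-- The set of positive roots, as vectors of the ambient module. -/
def posRoots : Set M := P.root '' {i | b.IsPos i}

variable {b}

lemma mem_posRoots_or_neg_mem {v : M} (hv : v ∈ Set.range P.root) :
    v ∈ b.posRoots ∨ -v ∈ b.posRoots := by
  obtain ⟨i, rfl⟩ := hv
  let := P.indexNeg
  rcases IsPos.or_neg b i with hi | hi
  · exact .inl ⟨i, hi, rfl⟩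
  · exact .inr ⟨-i, hi, by simp⟩

lemma neg_notMem_posRoots {v : M} (hv : v ∈ b.posRoots) : -v ∉ b.posRoots := by
  obtain ⟨i, hi, rfl⟩ := hv
  rintro ⟨j, hj, hij⟩
  let := P.indexNeg
  have : j = -i := P.root.injective (by simp [hij])
  exact (IsPos.neg_iff_not b i).mp (this ▸ hj) hi

lemma mem_range_of_mem_posRoots {v : M} (hv : v ∈ b.posRoots) : v ∈ Set.range P.root :=
  Set.image_subset_range _ _ hv

lemma root_mem_posRoots {i : ι} (hi : i ∈ b.support) : P.root i ∈ b.posRoots :=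
  ⟨i, isPos_of_mem_support hi, rfl⟩

lemma exists_eq_sum_nat_of_mem_posRoots {v : M} (hv : v ∈ b.posRoots) :
    ∃ f : ι → ℕ, v = ∑ j ∈ b.support, f j • P.root j := by
  obtain ⟨i, hi, rfl⟩ := hv
  obtain ⟨f, -, hf | hf⟩ := b.exists_root_eq_sum_nat_or_neg i
  · exact ⟨f, hf⟩
  · have h : b.height i = ∑ j ∈ b.support, -(f j : ℤ) :=
      height_eq_sum (f := fun j ↦ -(f j : ℤ)) (by simp [hf])
    have h₁ : 0 < b.height i := hi
    have h₂ : ∑ j ∈ b.support, -(f j : ℤ) ≤ 0 := Finset.sum_nonpos (by simp)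
    lia

omit [CharZero R] in
lemma reflection_mem_range (i : ι) {v : M} (hv : v ∈ Set.range P.root) :
    P.reflection i v ∈ Set.range P.root :=
  P.mapsTo_reflection_root i hv

section Finite

variable [Finite ι] [IsDomain R] [P.IsCrystallographic] [P.IsReduced]

/-- A simple reflection permutes the positive roots other than the simple root defining it. -/
lemma reflection_mem_posRoots {i : ι} (hi : i ∈ b.support) {v : M} (hv : v ∈ b.posRoots)
    (hne : v ≠ P.root i) : P.reflection i v ∈ b.posRoots := by
  obtain ⟨j, hj, rfl⟩ := hv
  exact ⟨P.reflectionPerm i j, IsPos.reflectionPerm hj hi (by rintro rfl; exact hne rfl), by simp⟩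

/-- If a product of simple reflections makes a positive root negative, then some factor is applied
to the simple root that defines it. -/
lemma exists_prod_reflection_apply_eq (L : List ι) (hL : ∀ i ∈ L, i ∈ b.support) {v : M}
    (hv : v ∈ b.posRoots) (h : (L.map P.reflection).prod v ∉ b.posRoots) :
    ∃ A j B, L = A ++ j :: B ∧ (B.map P.reflection).prod v = P.root j := by
  induction L with
  | nil => exact absurd (by simpa using hv) h
  | cons a L ih =>
    by_cases h' : (L.map P.reflection).prod v ∈ b.posRoots
    · refine ⟨[], a, L, rfl, ?_⟩
      by_contra hne
      exact h (by simpa using reflection_mem_posRoots (hL a (by simp)) h' hne)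
    · obtain ⟨A, j, B, rfl, hB⟩ := ih (fun i hi ↦ hL i (by simp [hi])) h'
      exact ⟨a :: A, j, B, rfl, hB⟩

omit [CharZero R] [Finite ι] [IsDomain R] [P.IsCrystallographic] [P.IsReduced] in
lemma prod_reflection_mul_reflection (L : List ι) (i : ι) :
    ∃ j, (L.map P.reflection).prod (P.root i) = P.root j ∧
      (L.map P.reflection).prod * P.reflection i = P.reflection j * (L.map P.reflection).prod := by
  induction L with
  | nil => exact ⟨i, by simp⟩
  | cons a L ih =>
    obtain ⟨j, hj, hj'⟩ := ih
    refine ⟨P.reflectionPerm a j, by simp [hj], ?_⟩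
    have h : P.reflection (P.reflectionPerm a j) = P.reflection a * P.reflection j *
        P.reflection a := by rw [reflection_reflectionPerm]
    have h₂ : P.reflection a * P.reflection a = 1 := by rw [← sq, reflection_sq]
    rw [h, List.map_cons, List.prod_cons, mul_assoc, hj', mul_assoc _ (P.reflection a),
      ← mul_assoc (P.reflection a) (P.reflection a), h₂]
    simp [mul_assoc]

/-- A product of simple reflections that maps the simple roots to positive roots is trivial. The
proof is the deletion argument: a nonempty word for such a product can be shortened by two
letters. -/
theorem prod_reflection_eq_one (L : List ι) (hL : ∀ i ∈ L, i ∈ b.support)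
    (h : ∀ i ∈ b.support, (L.map P.reflection).prod (P.root i) ∈ b.posRoots) :
    (L.map P.reflection).prod = 1 := by
  induction hn : L.length using Nat.strong_induction_on generalizing L with
  | _ n ih =>
    rcases L.eq_nil_or_concat with rfl | ⟨L', k, rfl⟩
    · simp
    have hk : k ∈ b.support := hL k (by simp)
    have hneg : (L'.map P.reflection).prod (P.root k) ∉ b.posRoots := by
      have := h k hk
      intro h'
      exact neg_notMem_posRoots h' (by simpa using this)
    obtain ⟨A, j, B, rfl, hB⟩ := exists_prod_reflection_apply_eq L'
      (fun i hi ↦ hL i (by simp [hi])) (root_mem_posRoots hk) hneg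
    obtain ⟨j', hj', hj''⟩ := prod_reflection_mul_reflection (P := P) B k
    obtain rfl : j' = j := P.root.injective (hj'.symm.trans hB)
    have h₂ : P.reflection j' * P.reflection j' = 1 := by rw [← sq, reflection_sq]
    have key : (((A ++ j' :: B).concat k).map P.reflection).prod =
        ((A ++ B).map P.reflection).prod := by
      simp only [List.concat_eq_append, List.map_append, List.prod_append, List.map_cons,
        List.prod_cons, List.map_nil, List.prod_nil, mul_one]
      rw [mul_assoc, mul_assoc, hj'', ← mul_assoc (P.reflection j'), h₂, one_mul]
    rw [key]
    refine ih (A ++ B).length ?_ (A ++ B) (fun i hi ↦ hL i ?_) (fun i hi ↦ ?_) rfl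
    · simp [← hn]
    · simp only [List.mem_append] at hi; simp; tauto
    · rw [← key]; exact h i hi

end Finite

end RootPairing.Base

/-! ### Perron–Frobenius for symmetrizable matrices -/

open Matrix in
/-- A symmetric real matrix with nonnegative entries has a nonnegative eigenvector: if `x` maximises
the Rayleigh quotient, then so does the vector of absolute values of `x`. -/
lemma Matrix.IsSymm.exists_nonneg_mulVec_eq_smul {n : Type*} [Fintype n] [DecidableEq n]
    [Nonempty n] {S : Matrix n n ℝ} (hS : S.IsSymm) (hS₀ : ∀ i j, 0 ≤ S i j) :
    ∃ μ : ℝ, ∃ x : n → ℝ, (∀ i, 0 ≤ x i) ∧ x ≠ 0 ∧ S *ᵥ x = μ • x := by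
  let T : EuclideanSpace ℝ n →L[ℝ] EuclideanSpace ℝ n := toEuclideanCLM (𝕜 := ℝ) S
  have hT : IsSelfAdjoint T := by
    refine IsSelfAdjoint.map (?_ : IsSelfAdjoint S) (toEuclideanCLM (n := n) (𝕜 := ℝ))
    rw [IsSelfAdjoint, star_eq_conjTranspose, conjTranspose_eq_transpose_of_trivial]
    exact hS
  have hT' (x : EuclideanSpace ℝ n) : T.reApplyInnerSelf x = ∑ i, ∑ j, S i j * x j * x i := by
    simp [ContinuousLinearMap.reApplyInnerSelf, T, PiLp.inner_apply, mulVec, dotProduct,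
      Finset.mul_sum, mul_comm, mul_left_comm]
  obtain ⟨x, hx, hmax⟩ := (isCompact_sphere (0 : EuclideanSpace ℝ n) 1).exists_isMaxOn
    (NormedSpace.sphere_nonempty.mpr zero_le_one) T.reApplyInnerSelf_continuous.continuousOn
  let z : EuclideanSpace ℝ n := WithLp.toLp 2 fun i ↦ |x i|
  have hz : ‖z‖ = 1 := by
    rw [← mem_sphere_zero_iff_norm.mp hx, EuclideanSpace.norm_eq, EuclideanSpace.norm_eq]
    simp [z]
  have hxz : T.reApplyInnerSelf x ≤ T.reApplyInnerSelf z := by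
    rw [hT', hT']
    refine Finset.sum_le_sum fun i _ ↦ Finset.sum_le_sum fun j _ ↦ ?_
    rw [mul_assoc, mul_assoc]
    refine mul_le_mul_of_nonneg_left ?_ (hS₀ i j)
    rw [← abs_mul]
    exact le_abs_self _
  have hmax' : IsMaxOn T.reApplyInnerSelf (Metric.sphere 0 ‖z‖) z := by
    rw [hz]
    exact fun w hw ↦ (hmax hw).trans hxz
  have hev := hT.eq_smul_self_of_isLocalExtrOn_real (.inr hmax'.localize)
  refine ⟨T.rayleighQuotient z, z.ofLp, fun i ↦ abs_nonneg _, fun h ↦ ?_, ?_⟩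
  · have : z = 0 := by ext i; simpa using congrFun h i
    simp [this] at hz
  · simpa [T] using congrArg WithLp.ofLp hev

open Matrix in
/-- Perron–Frobenius: an irreducible symmetrizable real matrix with nonnegative entries has an
eigenvector with positive entries. -/
theorem Matrix.exists_pos_mulVec_eq_smul {n : Type*} [Fintype n] [DecidableEq n] [Nonempty n]
    {T : Matrix n n ℝ} {d : n → ℝ} (hd : ∀ i, 0 < d i) (hTd : (T * diagonal d).IsSymm)
    (hT₀ : ∀ i j, 0 ≤ T i j)
    (hT : ∀ s : Set n, s.Nonempty → (∀ i ∈ s, ∀ j, T j i ≠ 0 → j ∈ s) → s = Set.univ) :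
    ∃ μ : ℝ, ∃ p : n → ℝ, (∀ i, 0 < p i) ∧ T *ᵥ p = μ • p := by
  let r : n → ℝ := fun i ↦ √(d i)
  have hr (i) : 0 < r i := Real.sqrt_pos.mpr (hd i)
  have hr' (i) : r i * r i = d i := Real.mul_self_sqrt (hd i).le
  let S : Matrix n n ℝ := of fun i j ↦ T i j * r j / r i
  have hS : S.IsSymm := by
    ext i j
    have h := congrFun₂ hTd i j
    simp only [transpose_apply, mul_diagonal] at h
    simp only [S, transpose_apply, of_apply]
    rw [div_eq_div_iff (hr j).ne' (hr i).ne', mul_assoc, mul_assoc, hr', hr', h]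
  obtain ⟨μ, x, hx₀, hx, hSx⟩ := hS.exists_nonneg_mulVec_eq_smul
    fun i j ↦ div_nonneg (mul_nonneg (hT₀ i j) (hr j).le) (hr i).le
  let p : n → ℝ := fun i ↦ r i * x i
  have hp₀ (i) : 0 ≤ p i := mul_nonneg (hr i).le (hx₀ i)
  have hTp : T *ᵥ p = μ • p := by
    ext i
    have h := congrFun hSx i
    simp only [mulVec, dotProduct, S, of_apply, Pi.smul_apply, smul_eq_mul] at h ⊢
    rw [show μ * p i = r i * (μ * x i) by simp only [p]; ring, ← h, Finset.mul_sum]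
    refine Finset.sum_congr rfl fun j _ ↦ ?_
    have := (hr i).ne'
    simp only [p]
    field_simp
  refine ⟨μ, p, ?_, hTp⟩
  -- The support of `p` is closed under adjacency, hence everything.
  have hsupp : {i | 0 < p i} = Set.univ := by
    refine hT _ ?_ fun i hi j hji ↦ (hp₀ j).lt_of_ne fun h0 ↦ ?_
    · obtain ⟨i, hi⟩ := Function.ne_iff.mp hx
      exact ⟨i, mul_pos (hr i) ((hx₀ i).lt_of_ne hi.symm)⟩
    · have h := congrFun hTp j
      simp only [mulVec, dotProduct, Pi.smul_apply, ← h0, smul_zero] at h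
      rw [Finset.sum_eq_zero_iff_of_nonneg fun k _ ↦ mul_nonneg (hT₀ j k) (hp₀ k)] at h
      exact (mul_ne_zero hji (ne_of_gt hi)) (h i (Finset.mem_univ i))
  exact fun i ↦ hsupp.ge (Set.mem_univ i)

/-! ### The two involutions of a bipartition -/

namespace RootPairing.Base

section Reflections

variable {ι R M N : Type*} [CommRing R] [AddCommGroup M] [Module R M] [AddCommGroup N] [Module R N]
  {P : RootPairing ι R M N} [DecidableEq ι] {b : P.Base}

namespace OrthogonalBipartition

/-- The bipartition with the two parts exchanged. -/
def swap (c : b.OrthogonalBipartition) : b.OrthogonalBipartition where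
  I₁ := c.I₂
  I₂ := c.I₁
  disjoint := c.disjoint.symm
  union_eq := by rw [Finset.union_comm, c.union_eq]
  orthogonal₁ := c.orthogonal₂
  orthogonal₂ := c.orthogonal₁

variable (c : b.OrthogonalBipartition)

lemma swap_τ₁ : c.swap.τ₁ = c.τ₂ := rfl

variable {c}

lemma mem_support_of_mem₁ {i : ι} (hi : i ∈ c.I₁) : i ∈ b.support :=
  c.union_eq ▸ Finset.mem_union_left _ hi

lemma mem_support_of_mem₂ {i : ι} (hi : i ∈ c.I₂) : i ∈ b.support :=
  c.union_eq ▸ Finset.mem_union_right _ hi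

lemma mem₁_or_mem₂ {i : ι} (hi : i ∈ b.support) : i ∈ c.I₁ ∨ i ∈ c.I₂ :=
  Finset.mem_union.mp (c.union_eq.symm ▸ hi)

lemma notMem₁_of_mem₂ {i : ι} (hi : i ∈ c.I₂) : i ∉ c.I₁ :=
  fun h ↦ Finset.disjoint_left.mp c.disjoint h hi

lemma notMem₂_of_mem₁ {i : ι} (hi : i ∈ c.I₁) : i ∉ c.I₂ :=
  Finset.disjoint_left.mp c.disjoint hi

lemma β_of_mem₁ {i : ι} (hi : i ∈ c.I₁) : c.β i = P.root i := if_pos hi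

lemma β_of_mem₂ {i : ι} (hi : i ∈ c.I₂) : c.β i = -P.root i := if_neg (notMem₁_of_mem₂ hi)

variable (c)

lemma τ₁_apply (v : M) : c.τ₁ v = v - ∑ i ∈ c.I₁, P.coroot' i v • P.root i := by
  suffices ∀ (J : Finset ι) (_ : (J : Set ι).Pairwise P.IsOrthogonal)
      (hc : (J : Set ι).Pairwise (Function.onFun Commute P.reflection)),
      J.noncommProd P.reflection hc v = v - ∑ i ∈ J, P.coroot' i v • P.root i from
    this _ c.orthogonal₁ _
  intro J
  induction J using Finset.induction_on with
  | empty => simp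
  | insert a J ha ih =>
    intro hJ hc
    rw [Finset.noncommProd_insert_of_notMem _ _ _ _ ha, LinearEquiv.mul_apply,
      ih (hJ.mono (by simp)) (hc.mono (by simp)), Finset.sum_insert ha, reflection_apply]
    have h : P.coroot' a (∑ i ∈ J, P.coroot' i v • P.root i) = 0 := by
      rw [map_sum]
      refine Finset.sum_eq_zero fun i hi ↦ ?_
      have hai : P.IsOrthogonal i a := hJ (by simp [hi]) (by simp) (by rintro rfl; exact ha hi)
      simp [hai.1]
    rw [map_sub, h]
    module

lemma τ₁_τ₁_apply (v : M) : c.τ₁ (c.τ₁ v) = v := by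
  have h (k) (hk : k ∈ c.I₁) : P.coroot' k (c.τ₁ v) = -P.coroot' k v := by
    rw [τ₁_apply, map_sub, map_sum, Finset.sum_eq_single_of_mem k hk]
    · simp; ring
    · intro i hi hik
      simp [(c.orthogonal₁ hi hk hik).1]
  rw [τ₁_apply c (c.τ₁ v), Finset.sum_congr rfl fun k hk ↦ by rw [h k hk], τ₁_apply]
  simp

lemma exists_list_τ₁ : ∃ L : List ι, (∀ i ∈ L, i ∈ b.support) ∧ c.τ₁ = (L.map P.reflection).prod := by
  suffices ∀ (J : Finset ι) (hc : (J : Set ι).Pairwise (Function.onFun Commute P.reflection)),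
      J ⊆ b.support → ∃ L : List ι, (∀ i ∈ L, i ∈ b.support) ∧ J.noncommProd P.reflection hc =
        (L.map P.reflection).prod from this _ _ fun _ ↦ mem_support_of_mem₁
  intro J
  induction J using Finset.induction_on with
  | empty => exact fun _ _ ↦ ⟨[], by simp⟩
  | insert a J ha ih =>
    intro hc hs
    obtain ⟨L, hL, hL'⟩ := ih (hc.mono (by simp)) ((Finset.subset_insert _ _).trans hs)
    refine ⟨a :: L, by simpa using ⟨hs (by simp), hL⟩, ?_⟩
    rw [Finset.noncommProd_insert_of_notMem _ _ _ _ ha, hL']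
    simp

/-- The powers of `σ` are products of simple reflections. -/
lemma exists_list_σ_pow (n : ℕ) :
    ∃ L : List ι, (∀ i ∈ L, i ∈ b.support) ∧ c.σ ^ n = (L.map P.reflection).prod := by
  obtain ⟨L₁, h₁, e₁⟩ := c.exists_list_τ₁
  obtain ⟨L₂, h₂, e₂⟩ := c.swap.exists_list_τ₁
  rw [swap_τ₁] at e₂
  induction n with
  | zero => exact ⟨[], by simp⟩
  | succ n ih =>
    obtain ⟨L, hL, e⟩ := ih
    refine ⟨L ++ (L₂ ++ L₁), ?_, by rw [pow_succ, e, σ, e₁, e₂]; simp⟩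
    simp only [List.mem_append]
    rintro i (h | h | h)
    exacts [hL i h, h₂ i h, h₁ i h]

lemma τ₁_mem_range {v : M} (hv : v ∈ Set.range P.root) : c.τ₁ v ∈ Set.range P.root := by
  obtain ⟨L, -, e⟩ := c.exists_list_τ₁
  rw [e]
  clear e
  induction L with
  | nil => simpa using hv
  | cons a L ih => simpa using reflection_mem_range a ih

lemma τ₁_root {i : ι} (hi : i ∈ c.I₁) : c.τ₁ (P.root i) = -P.root i := by
  rw [τ₁_apply, Finset.sum_eq_single_of_mem i hi]
  · simp [two_smul]
  · intro k hk hki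
    simp [(c.orthogonal₁ hk hi hki).2]

end OrthogonalBipartition

end Reflections

/-! ### Perron weights -/

section Perron

variable {ι M N : Type*} [AddCommGroup M] [Module ℂ M] [AddCommGroup N] [Module ℂ N]
  {P : RootPairing ι ℂ M N}

/-- An eigenvector with positive entries of the matrix `2 - A`, where `A` is the Cartan matrix of
the base `b`; the entries are indexed by all roots, and only those at simple roots matter. -/
structure PerronVector (b : P.Base) where
  p : ι → ℝ
  μ : ℝ
  pos : ∀ i ∈ b.support, 0 < p i
  sum_eq : ∀ j ∈ b.support, ∑ k ∈ b.support, P.pairing j k * p k = (2 - μ) * p j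

/-- The Cartan matrix is symmetrizable, and irreducibility makes its Dynkin diagram connected, so
that the Perron–Frobenius theorem applies. -/
lemma nonempty_perronVector [Finite ι] [Nonempty ι] [P.IsRootSystem] [P.IsCrystallographic]
    [P.IsReduced] [P.IsIrreducible] (b : P.Base) : Nonempty (PerronVector b) := by
  classical
  obtain ⟨d, hd, hA⟩ := b.exists_cartanMatrix_mul_diagaonal_posDef
  let A : Matrix b.support b.support ℝ := b.cartanMatrix.map (Int.cast)
  have hA' (i j) : A i j = (b.cartanMatrix i j : ℝ) := rfl
  have : Nonempty b.support := b.support_nonempty.to_subtype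
  have hsymm : ((2 - A) * Matrix.diagonal fun i ↦ (d i : ℝ)).IsSymm := by
    ext i j
    have h := congrFun₂ hA.isHermitian i j
    simp only [Matrix.conjTranspose_apply, Matrix.mul_diagonal, star_trivial] at h
    have h' : (b.cartanMatrix j i : ℝ) * d i = b.cartanMatrix i j * d j := by exact_mod_cast h
    simp only [Matrix.transpose_apply, Matrix.mul_diagonal, Matrix.sub_apply, hA']
    rcases eq_or_ne i j with rfl | hij
    · rfl
    · simp [Matrix.ofNat_apply, hij, hij.symm, h']
  have hnonneg (i j) : 0 ≤ (2 - A) i j := by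
    rcases eq_or_ne i j with rfl | hij
    · simp [hA', Matrix.ofNat_apply]
    · have := b.cartanMatrix_le_zero_of_ne i j hij
      simpa [hA', Matrix.ofNat_apply, hij] using this
  have hirr (s : Set b.support) (hne : s.Nonempty)
      (hs : ∀ i ∈ s, ∀ j, (2 - A) j i ≠ 0 → j ∈ s) : s = Set.univ := by
    obtain ⟨i, hi⟩ := hne
    refine Set.eq_univ_of_forall fun j ↦ b.induction_on_cartanMatrix (· ∈ s) hi fun k l hk hkl ↦ ?_
    rcases eq_or_ne l k with rfl | hlk
    · exact hk
    · refine hs k hk l ?_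
      simpa [hA', Matrix.ofNat_apply, hlk] using hkl
  obtain ⟨μ, p, hp, he⟩ := Matrix.exists_pos_mulVec_eq_smul
    (fun i ↦ by exact_mod_cast hd i) hsymm hnonneg hirr
  refine ⟨⟨fun i ↦ if h : i ∈ b.support then p ⟨i, h⟩ else 0, μ, fun i hi ↦ by simp [hi, hp],
    fun j hj ↦ ?_⟩⟩
  have h' : ∑ x, A ⟨j, hj⟩ x * p x = (2 - μ) * p ⟨j, hj⟩ := by
    have h := congrFun he ⟨j, hj⟩
    rw [Matrix.sub_mulVec, Matrix.ofNat_mulVec] at h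
    have h₂ : 2 * p ⟨j, hj⟩ - ∑ x, A ⟨j, hj⟩ x * p x = μ * p ⟨j, hj⟩ := h
    linarith
  have h'' := congrArg (fun x : ℝ ↦ (x : ℂ)) h'
  push_cast at h''
  rw [← Finset.sum_coe_sort]
  simp only [Finset.coe_mem, dif_pos, hj]
  rw [← h'']
  refine Finset.sum_congr rfl fun x _ ↦ ?_
  rw [← P.algebraMap_pairingIn ℤ j x, hA']
  simp [cartanMatrixIn_def]

namespace PerronVector

variable {b : P.Base} (w : PerronVector b) [DecidableEq ι] [P.IsRootSystem]

/-- The linear form whose value on a simple root is its Perron weight if the simple root belongs to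
`J`, and zero otherwise. -/
noncomputable def form (J : Finset ι) : M →ₗ[ℂ] ℂ :=
  b.toWeightBasis.constr ℂ fun i ↦ if (i : ι) ∈ J then (w.p i : ℂ) else 0

lemma form_root (J : Finset ι) {i : ι} (hi : i ∈ b.support) :
    w.form J (P.root i) = if i ∈ J then (w.p i : ℂ) else 0 := by
  have h := b.toWeightBasis.constr_basis ℂ
    (fun i : b.support ↦ if (i : ι) ∈ J then (w.p i : ℂ) else 0) ⟨i, hi⟩
  rwa [toWeightBasis_apply] at h

/-- The real part of `PerronVector.form`. On the root lattice, the form is real-valued. -/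
noncomputable def wt (J : Finset ι) : M →+ ℝ :=
  Complex.reAddGroupHom.comp (w.form J).toAddMonoidHom

lemma wt_apply (J : Finset ι) (v : M) : w.wt J v = (w.form J v).re := rfl

lemma wt_root_of_mem {J : Finset ι} {i : ι} (hi : i ∈ b.support) (h : i ∈ J) :
    w.wt J (P.root i) = w.p i := by
  simp [wt_apply, w.form_root J hi, h]

lemma wt_root_of_notMem {J : Finset ι} {i : ι} (hi : i ∈ b.support) (h : i ∉ J) :
    w.wt J (P.root i) = 0 := by
  simp [wt_apply, w.form_root J hi, h]

variable (c : b.OrthogonalBipartition)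

lemma wt₁_τ₁ (v : M) : w.wt c.I₁ (c.τ₁ v) = -w.wt c.I₁ v + w.μ * w.wt c.I₂ v := by
  suffices w.form c.I₁ ∘ₗ c.τ₁.toLinearMap = -w.form c.I₁ + (w.μ : ℂ) • w.form c.I₂ by
    have h := congrArg Complex.re (LinearMap.congr_fun this v)
    simpa [wt_apply] using h
  refine b.toWeightBasis.ext fun ⟨j, hj⟩ ↦ ?_
  have hτ : w.form c.I₁ (c.τ₁ (P.root j)) =
      w.form c.I₁ (P.root j) - ∑ k ∈ c.I₁, P.pairing j k * w.p k := by
    rw [OrthogonalBipartition.τ₁_apply, map_sub, map_sum]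
    congr 1
    refine Finset.sum_congr rfl fun k hk ↦ ?_
    simp [w.form_root c.I₁ (OrthogonalBipartition.mem_support_of_mem₁ hk), hk]
  have hsum := w.sum_eq j hj
  rw [← c.union_eq, Finset.sum_union c.disjoint] at hsum
  simp only [toWeightBasis_apply, LinearMap.comp_apply, LinearEquiv.coe_coe, hτ,
    LinearMap.add_apply, LinearMap.neg_apply, LinearMap.smul_apply, smul_eq_mul, w.form_root _ hj]
  rcases OrthogonalBipartition.mem₁_or_mem₂ (c := c) hj with h | h
  · have h' : j ∉ c.I₂ := OrthogonalBipartition.notMem₂_of_mem₁ h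
    have : ∑ k ∈ c.I₁, P.pairing j k * w.p k = 2 * w.p j := by
      rw [Finset.sum_eq_single_of_mem j h]
      · simp
      · intro k hk hkj
        simp [(c.orthogonal₁ hk h hkj).2]
    simp only [h, h', this, if_true, if_false]
    ring
  · have h' : j ∉ c.I₁ := OrthogonalBipartition.notMem₁_of_mem₂ h
    have : ∑ k ∈ c.I₂, P.pairing j k * w.p k = 2 * w.p j := by
      rw [Finset.sum_eq_single_of_mem j h]
      · simp
      · intro k hk hkj
        simp [(c.orthogonal₂ hk h hkj).2]
    simp only [h, h', if_true, if_false]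
    linear_combination -hsum + this

lemma wt₂_τ₁ (v : M) : w.wt c.I₂ (c.τ₁ v) = w.wt c.I₂ v := by
  rw [OrthogonalBipartition.τ₁_apply, map_sub, sub_eq_self, map_sum]
  refine Finset.sum_eq_zero fun k hk ↦ ?_
  have hk' : k ∉ c.I₂ := OrthogonalBipartition.notMem₂_of_mem₁ hk
  simp [wt_apply, w.form_root c.I₂ (OrthogonalBipartition.mem_support_of_mem₁ hk), hk']

lemma wt_sum_nat (J : Finset ι) (f : ι → ℕ) :
    w.wt J (∑ j ∈ b.support, f j • P.root j) = ∑ j ∈ b.support, if j ∈ J then f j * w.p j else 0 := by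
  rw [map_sum]
  refine Finset.sum_congr rfl fun j hj ↦ ?_
  rw [map_nsmul]
  split_ifs with h
  · simp [w.wt_root_of_mem hj h]
  · simp [w.wt_root_of_notMem hj h]

lemma wt_nonneg (J : Finset ι) {v : M} (hv : v ∈ b.posRoots) : 0 ≤ w.wt J v := by
  obtain ⟨f, rfl⟩ := exists_eq_sum_nat_of_mem_posRoots hv
  rw [wt_sum_nat]
  refine Finset.sum_nonneg fun j hj ↦ ?_
  split_ifs
  · exact mul_nonneg (Nat.cast_nonneg _) (w.pos j hj).le
  · rfl

lemma eq_zero_of_wt_sum_nat_eq_zero {J : Finset ι} {f : ι → ℕ}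
    (h : w.wt J (∑ j ∈ b.support, f j • P.root j) = 0) {j : ι} (hj : j ∈ b.support) (hJ : j ∈ J) :
    f j = 0 := by
  rw [wt_sum_nat, Finset.sum_eq_zero_iff_of_nonneg] at h
  · simpa [hJ, (w.pos j hj).ne'] using h j hj
  · intro j hj
    split_ifs
    · exact mul_nonneg (Nat.cast_nonneg _) (w.pos j hj).le
    · rfl

lemma wt_add_wt_pos {v : M} (hv : v ∈ b.posRoots) : 0 < w.wt c.I₁ v + w.wt c.I₂ v := by
  have h₁ := w.wt_nonneg c.I₁ hv
  have h₂ := w.wt_nonneg c.I₂ hv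
  refine (add_nonneg h₁ h₂).lt_of_ne' fun h ↦ ?_
  obtain ⟨f, rfl⟩ := exists_eq_sum_nat_of_mem_posRoots hv
  obtain ⟨i, -, hi⟩ := hv
  apply P.ne_zero i
  rw [hi]
  refine Finset.sum_eq_zero fun j hj ↦ ?_
  have : f j = 0 := by
    rcases OrthogonalBipartition.mem₁_or_mem₂ (c := c) hj with h' | h'
    · exact w.eq_zero_of_wt_sum_nat_eq_zero (by linarith) hj h'
    · exact w.eq_zero_of_wt_sum_nat_eq_zero (by linarith) hj h'
  simp [this]

/-- A positive root supported in `I₁` is simple, because the simple roots in `I₁` are pairwise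
orthogonal. -/
lemma exists_eq_root_of_wt₂_eq_zero [Finite ι] [P.IsCrystallographic] [P.IsReduced] {v : M}
    (hv : v ∈ b.posRoots) (h₂ : w.wt c.I₂ v = 0) : ∃ i ∈ c.I₁, v = P.root i := by
  obtain ⟨f, hf⟩ := exists_eq_sum_nat_of_mem_posRoots hv
  have hf₂ (j) (hj : j ∈ c.I₂) : f j = 0 := w.eq_zero_of_wt_sum_nat_eq_zero (hf ▸ h₂)
    (OrthogonalBipartition.mem_support_of_mem₂ hj) hj
  obtain ⟨j, hj, hfj⟩ : ∃ j ∈ b.support, f j ≠ 0 := by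
    by_contra! h
    obtain ⟨i, -, rfl⟩ := hv
    exact P.ne_zero i (hf.trans (Finset.sum_eq_zero fun j hj ↦ by simp [h j hj]))
  have hj₁ : j ∈ c.I₁ := (OrthogonalBipartition.mem₁_or_mem₂ hj).resolve_right (hfj ∘ hf₂ j)
  refine ⟨j, hj₁, ?_⟩
  by_contra hne
  -- Otherwise `P.reflection j v` is positive, but its coefficient at the simple root `j` is `-f j`.
  obtain ⟨g, hg⟩ := exists_eq_sum_nat_of_mem_posRoots (reflection_mem_posRoots hj hv hne)
  have hcoroot : P.coroot' j v = 2 * f j := by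
    rw [hf, map_sum, Finset.sum_eq_single_of_mem j hj]
    · simp [mul_comm]
    · intro k hk hkj
      rcases OrthogonalBipartition.mem₁_or_mem₂ (c := c) hk with h' | h'
      · simp [(c.orthogonal₁ h' hj₁ hkj).1]
      · simp [hf₂ k h']
  have hwt (f : ι → ℕ) : w.wt {j} (∑ k ∈ b.support, f k • P.root k) = f j * w.p j := by
    rw [wt_sum_nat, Finset.sum_eq_single_of_mem j hj]
    · simp
    · intro k _ hkj
      simp [hkj]
  have hrefl : w.wt {j} (P.reflection j v) = -(f j * w.p j) := by
    rw [reflection_apply, hcoroot, map_sub,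
      show ((2 : ℂ) * f j) • P.root j = (2 * f j) • P.root j by
        rw [← Nat.cast_smul_eq_nsmul ℂ]; push_cast; rfl,
      map_nsmul, w.wt_root_of_mem hj (by simp), hf, hwt]
    simp; ring
  rw [hg, hwt] at hrefl
  have h₁ : 0 ≤ (g j : ℝ) * w.p j := mul_nonneg (Nat.cast_nonneg _) (w.pos j hj).le
  have h₃ : 0 < (f j : ℝ) * w.p j := mul_pos (by positivity) (w.pos j hj)
  linarith

end PerronVector

end Perron

end RootPairing.Base

/-! ### The weight recurrence -/

/-- The solution of `y (n + 2) = μ * y (n + 1) - y n` with `y 0 = 0` and `y 1 = 1`; up to a shift of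
the index, the rescaled Chebyshev polynomials of the second kind evaluated at `μ`. -/
noncomputable def coxeterSeq (μ : ℝ) : ℕ → ℝ
  | 0 => 0
  | 1 => 1
  | n + 2 => μ * coxeterSeq μ (n + 1) - coxeterSeq μ n

namespace coxeterSeq

variable {μ : ℝ}

@[simp] lemma apply_zero : coxeterSeq μ 0 = 0 := rfl

@[simp] lemma apply_one : coxeterSeq μ 1 = 1 := rfl

lemma add_two (n : ℕ) : coxeterSeq μ (n + 2) = μ * coxeterSeq μ (n + 1) - coxeterSeq μ n := rfl

lemma add_of_eq_zero {m : ℕ} (h : coxeterSeq μ (m + 1) = 0) (k : ℕ) :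
    coxeterSeq μ (m + 1 + k) = -coxeterSeq μ m * coxeterSeq μ k := by
  induction k using Nat.twoStepInduction with
  | zero => simp [h]
  | one => rw [add_two, h]; simp
  | more k h₁ h₂ =>
    rw [add_two k, ← add_assoc, add_two (m + 1 + k), add_assoc _ k 1, h₁, h₂]
    ring

lemma two_eq_natCast (n : ℕ) : coxeterSeq 2 n = n := by
  induction n using Nat.twoStepInduction with
  | zero => simp
  | one => simp
  | more k h₁ h₂ =>
    rw [add_two, h₁, h₂]
    push_cast
    ring

/-- If the sequence first returns to zero at `n`, from above, then it is periodic of period `2 * n`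
up to positive factors, and it crosses zero upwards only at the multiples of `2 * n`. -/
lemma two_mul_dvd {n : ℕ} (hn : 0 < n) (h₀ : coxeterSeq μ n = 0)
    (hpos : ∀ k, 0 < k → k < n → 0 < coxeterSeq μ k) {m : ℕ} (hm : coxeterSeq μ m = 0)
    (hm' : 0 < coxeterSeq μ (m + 1)) : 2 * n ∣ m := by
  obtain ⟨l, rfl⟩ : ∃ l, n = l + 1 := ⟨n - 1, by lia⟩
  have hl : 0 < coxeterSeq μ l := by
    rcases Nat.eq_zero_or_pos l with rfl | hl
    · simp at h₀
    · exact hpos l hl (by lia)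
  have hadd := add_of_eq_zero h₀
  induction m using Nat.strong_induction_on with
  | _ m ih =>
    rcases Nat.eq_zero_or_pos m with rfl | hm₀
    · exact dvd_zero _
    rcases lt_or_ge m (l + 1) with h | h
    · exact absurd hm (hpos m hm₀ h).ne'
    obtain ⟨k, rfl⟩ := Nat.exists_eq_add_of_le h
    rw [hadd] at hm
    rw [add_assoc, hadd] at hm'
    have hk₀ : coxeterSeq μ k = 0 := by simpa [hl.ne'] using hm
    have hk₁ : coxeterSeq μ (k + 1) < 0 := by nlinarith
    rcases lt_or_ge k (l + 1) with h' | h'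
    · rcases Nat.eq_zero_or_pos k with rfl | hk
      · simp at hk₁; linarith
      · exact absurd hk₀ (hpos k hk h').ne'
    obtain ⟨j, rfl⟩ := Nat.exists_eq_add_of_le h'
    rw [hadd] at hk₀
    rw [add_assoc, hadd] at hk₁
    have := ih j (by lia) (by simpa [hl.ne'] using hk₀) (by nlinarith)
    rw [← add_assoc, ← two_mul]
    exact dvd_add (dvd_refl _) this

lemma two_mul_eq_zero {n : ℕ} (hn : 0 < n) (h₀ : coxeterSeq μ n = 0) :
    coxeterSeq μ (2 * n) = 0 := by
  obtain ⟨l, rfl⟩ : ∃ l, n = l + 1 := ⟨n - 1, by lia⟩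
  rw [two_mul, add_of_eq_zero h₀, h₀, mul_zero]

lemma two_mul_add_one_pos {n : ℕ} (h₀ : coxeterSeq μ n = 0)
    (hpos : ∀ k, 0 < k → k < n → 0 < coxeterSeq μ k) (hn : 0 < n) :
    0 < coxeterSeq μ (2 * n + 1) := by
  obtain ⟨l, rfl⟩ : ∃ l, n = l + 1 := ⟨n - 1, by lia⟩
  have hl : 0 < coxeterSeq μ l := by
    rcases Nat.eq_zero_or_pos l with rfl | hl
    · simp at h₀
    · exact hpos l hl (by lia)
  rw [two_mul, add_assoc, add_of_eq_zero h₀, add_of_eq_zero h₀, apply_one]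
  nlinarith

end coxeterSeq

/-! ### Orbits of the bipartite Coxeter element -/

namespace RootPairing.Base.OrthogonalBipartition

section Roots

variable {ι R M N : Type*} [CommRing R] [AddCommGroup M] [Module R M] [AddCommGroup N] [Module R N]
  {P : RootPairing ι R M N} [DecidableEq ι] {b : P.Base} (c : b.OrthogonalBipartition)

lemma σ_apply (v : M) : c.σ v = c.τ₂ (c.τ₁ v) := rfl

lemma τ₂_mem_range {v : M} (hv : v ∈ Set.range P.root) : c.τ₂ v ∈ Set.range P.root :=
  c.swap.τ₁_mem_range hv

lemma σ_pow_mem_range (k : ℕ) {v : M} (hv : v ∈ Set.range P.root) :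
    (c.σ ^ k) v ∈ Set.range P.root := by
  induction k with
  | zero => simpa using hv
  | succ k ih => rw [pow_succ', LinearEquiv.mul_apply]; exact c.τ₂_mem_range (c.τ₁_mem_range ih)

lemma β_mem_range (i : ι) : c.β i ∈ Set.range P.root := by
  unfold β
  split_ifs
  · exact ⟨i, rfl⟩
  · exact P.neg_root_mem i

variable {c}

lemma mem_orbit_iff {n : ℕ} (hn : 0 < n) (hσ : c.σ ^ n = 1) {i : ι} {x : M} :
    x ∈ c.orbit i ↔ ∃ k : ℕ, (c.σ ^ k) (c.β i) = x := by
  have hfin : IsOfFinOrder c.σ := isOfFinOrder_iff_pow_eq_one.mpr ⟨n, hn, hσ⟩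
  constructor
  · rintro ⟨⟨g, hg⟩, rfl⟩
    obtain ⟨k, rfl⟩ := hfin.mem_powers_iff_mem_zpowers.mpr hg
    exact ⟨k, rfl⟩
  · rintro ⟨k, rfl⟩
    exact ⟨⟨c.σ ^ k, k, by simp⟩, rfl⟩

end Roots

variable {ι M N : Type*} [AddCommGroup M] [Module ℂ M] [AddCommGroup N] [Module ℂ N]
  {P : RootPairing ι ℂ M N} [DecidableEq ι] [P.IsRootSystem] {b : P.Base}
  (c : b.OrthogonalBipartition) (w : PerronVector b)

lemma wt₁_τ₂ (v : M) : w.wt c.I₁ (c.τ₂ v) = w.wt c.I₁ v := w.wt₂_τ₁ c.swap v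

lemma wt₂_τ₂ (v : M) : w.wt c.I₂ (c.τ₂ v) = -w.wt c.I₂ v + w.μ * w.wt c.I₁ v := w.wt₁_τ₁ c.swap v

lemma wt_σ_pow_β_of_mem₂ {i : ι} (hi : i ∈ c.I₂) (k : ℕ) :
    w.wt c.I₁ ((c.σ ^ k) (c.β i)) = -w.p i * coxeterSeq w.μ (2 * k) ∧
    w.wt c.I₂ ((c.σ ^ k) (c.β i)) = -w.p i * coxeterSeq w.μ (2 * k + 1) := by
  induction k with
  | zero =>
    simp [β_of_mem₂ hi, w.wt_root_of_mem (mem_support_of_mem₂ hi) hi,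
      w.wt_root_of_notMem (mem_support_of_mem₂ hi) (notMem₁_of_mem₂ hi)]
  | succ k ih =>
    rw [pow_succ', LinearEquiv.mul_apply, σ_apply, wt₁_τ₂, wt₂_τ₂, w.wt₁_τ₁, w.wt₂_τ₁, ih.1, ih.2,
      show 2 * (k + 1) = 2 * k + 2 by ring, coxeterSeq.add_two, coxeterSeq.add_two,
      coxeterSeq.add_two]
    constructor <;> ring

lemma wt_σ_pow_β_of_mem₁ {i : ι} (hi : i ∈ c.I₁) (k : ℕ) :
    w.wt c.I₂ ((c.σ ^ k) (c.β i)) = -w.p i * coxeterSeq w.μ (2 * k) ∧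
    w.wt c.I₁ ((c.σ ^ k) (c.β i)) =
      w.p i * (coxeterSeq w.μ (2 * k + 1) - w.μ * coxeterSeq w.μ (2 * k)) := by
  induction k with
  | zero =>
    simp [β_of_mem₁ hi, w.wt_root_of_mem (mem_support_of_mem₁ hi) hi,
      w.wt_root_of_notMem (mem_support_of_mem₁ hi) (notMem₂_of_mem₁ hi)]
  | succ k ih =>
    rw [pow_succ', LinearEquiv.mul_apply, σ_apply, wt₁_τ₂, wt₂_τ₂, w.wt₁_τ₁, w.wt₂_τ₁, ih.1, ih.2,
      show 2 * (k + 1) = 2 * k + 2 by ring, coxeterSeq.add_two, coxeterSeq.add_two,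
      coxeterSeq.add_two]
    constructor <;> ring

lemma wt_mul_wt_nonneg {v : M} (hv : v ∈ Set.range P.root) : 0 ≤ w.wt c.I₁ v * w.wt c.I₂ v := by
  rcases mem_posRoots_or_neg_mem (b := b) hv with h | h
  · exact mul_nonneg (w.wt_nonneg _ h) (w.wt_nonneg _ h)
  · have := mul_nonneg (w.wt_nonneg c.I₁ h) (w.wt_nonneg c.I₂ h)
    simpa using this

/-- The weights of a root are a positive multiple of consecutive terms of the sequence, in one of
the two orders. -/
lemma exists_root_wt_eq [Nonempty ι] (m : ℕ) :
    ∃ v ∈ Set.range P.root, ∃ q : ℝ, 0 < q ∧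
      ((w.wt c.I₁ v = q * coxeterSeq w.μ m ∧ w.wt c.I₂ v = q * coxeterSeq w.μ (m + 1)) ∨
        (w.wt c.I₁ v = q * coxeterSeq w.μ (m + 1) ∧ w.wt c.I₂ v = q * coxeterSeq w.μ m)) := by
  induction m with
  | zero =>
    obtain ⟨i, hi⟩ := b.support_nonempty
    refine ⟨P.root i, ⟨i, rfl⟩, w.p i, w.pos i hi, ?_⟩
    rcases mem₁_or_mem₂ (c := c) hi with h | h
    · simp [w.wt_root_of_mem hi h, w.wt_root_of_notMem hi (notMem₂_of_mem₁ h)]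
    · simp [w.wt_root_of_mem hi h, w.wt_root_of_notMem hi (notMem₁_of_mem₂ h)]
  | succ m ih =>
    obtain ⟨v, hv, q, hq, ⟨h₁, h₂⟩ | ⟨h₁, h₂⟩⟩ := ih
    · refine ⟨_, c.τ₁_mem_range hv, q, hq, .inr ?_⟩
      rw [w.wt₁_τ₁, w.wt₂_τ₁, h₁, h₂, coxeterSeq.add_two]
      constructor <;> ring
    · refine ⟨_, c.τ₂_mem_range hv, q, hq, .inl ?_⟩
      rw [wt₁_τ₂, wt₂_τ₂, h₁, h₂, coxeterSeq.add_two]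
      constructor <;> ring

include c in
lemma coxeterSeq_mul_nonneg [Nonempty ι] (m : ℕ) :
    0 ≤ coxeterSeq w.μ m * coxeterSeq w.μ (m + 1) := by
  obtain ⟨v, hv, q, hq, ⟨h₁, h₂⟩ | ⟨h₁, h₂⟩⟩ := c.exists_root_wt_eq w m <;>
  · have h := c.wt_mul_wt_nonneg w hv
    rw [h₁, h₂] at h
    exact nonneg_of_mul_nonneg_right (a := q * q) (by linarith) (by positivity)

omit [P.IsRootSystem] in
/-- There are only finitely many roots, so that some power of `σ` fixes a given root. -/
lemma exists_σ_pow_apply_eq [Finite ι] {v : M} (hv : v ∈ Set.range P.root) :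
    ∃ k : ℕ, 0 < k ∧ (c.σ ^ k) v = v := by
  have : Finite (Set.range P.root) := Set.finite_range _
  obtain ⟨k, l, hkl, h⟩ := Finite.exists_ne_map_eq_of_infinite
    fun k : ℕ ↦ (⟨(c.σ ^ k) v, c.σ_pow_mem_range k hv⟩ : Set.range P.root)
  wlog hlt : k < l generalizing k l
  · exact this l k hkl.symm h.symm (by lia)
  obtain ⟨d, rfl⟩ := Nat.exists_eq_add_of_lt hlt
  refine ⟨d + 1, by lia, (c.σ ^ k).injective ?_⟩
  rw [← LinearEquiv.mul_apply, ← pow_add, ← add_assoc]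
  exact (congrArg Subtype.val h).symm

include c in
lemma exists_first_zero [Finite ι] [Nonempty ι] : ∃ n, 0 < n ∧ coxeterSeq w.μ n = 0 ∧
    ∀ k, 0 < k → k < n → 0 < coxeterSeq w.μ k := by
  have hex : ∃ n, 0 < n ∧ coxeterSeq w.μ n = 0 := by
    obtain ⟨i, hi⟩ := b.support_nonempty
    obtain ⟨k, hk, hk'⟩ := c.exists_σ_pow_apply_eq (c.β_mem_range i)
    refine ⟨2 * k, by lia, ?_⟩
    have hp := (w.pos i hi).ne'
    rcases mem₁_or_mem₂ (c := c) hi with h | h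
    · have h₁ := (c.wt_σ_pow_β_of_mem₁ w h k).1
      have h₂ := (c.wt_σ_pow_β_of_mem₁ w h 0).1
      rw [hk'] at h₁
      simpa [hp, h₁] using h₂
    · have h₁ := (c.wt_σ_pow_β_of_mem₂ w h k).1
      have h₂ := (c.wt_σ_pow_β_of_mem₂ w h 0).1
      rw [hk'] at h₁
      simpa [hp, h₁] using h₂
  classical
  refine ⟨Nat.find hex, (Nat.find_spec hex).1, (Nat.find_spec hex).2, fun k hk ↦ ?_⟩
  induction k, hk using Nat.le_induction with
  | base => simp
  | succ k hk ih =>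
    intro hlt
    have h₁ : 0 < coxeterSeq w.μ k := ih (by lia)
    have h₂ : 0 ≤ coxeterSeq w.μ (k + 1) :=
      nonneg_of_mul_nonneg_right (c.coxeterSeq_mul_nonneg w k) h₁
    exact h₂.lt_of_ne' fun h ↦ Nat.find_min hex hlt ⟨by lia, h⟩

section Order

variable {n : ℕ} (hn : 0 < n) (h₀ : coxeterSeq w.μ n = 0)
  (hpos : ∀ k, 0 < k → k < n → 0 < coxeterSeq w.μ k)

include hn h₀ hpos

omit hn h₀ hpos in
lemma mem_posRoots_of_wt_pos {J : Finset ι} {v : M} (hv : v ∈ Set.range P.root)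
    (h : 0 < w.wt J v) : v ∈ b.posRoots := by
  refine (mem_posRoots_or_neg_mem hv).resolve_right fun h' ↦ ?_
  have := w.wt_nonneg J h'
  rw [map_neg] at this
  linarith

/-- The weights show that `σ ^ n` maps simple roots to positive roots. -/
lemma σ_pow_eq_one [Finite ι] [P.IsCrystallographic] [P.IsReduced] : c.σ ^ n = 1 := by
  obtain ⟨L, hL, e⟩ := c.exists_list_σ_pow n
  rw [e]
  refine prod_reflection_eq_one L hL fun i hi ↦ ?_
  rw [← e]
  have hy := coxeterSeq.two_mul_eq_zero hn h₀
  have hy' := mul_pos (w.pos i hi) (coxeterSeq.two_mul_add_one_pos h₀ hpos hn)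
  have hr := c.σ_pow_mem_range n ⟨i, rfl⟩
  rcases mem₁_or_mem₂ (c := c) hi with h | h
  · have h₁ := (c.wt_σ_pow_β_of_mem₁ w h n).2
    rw [hy, β_of_mem₁ h] at h₁
    exact mem_posRoots_of_wt_pos w hr (J := c.I₁) (by linarith)
  · have h₁ := (c.wt_σ_pow_β_of_mem₂ w h n).2
    rw [β_of_mem₂ h, map_neg, map_neg] at h₁
    exact mem_posRoots_of_wt_pos w hr (J := c.I₂) (by linarith)

/-- In each of the four cases for the parts containing `i` and `j`, comparing weights locates an
upward zero crossing of the sequence: at `2 * k` if the parts agree, and at an odd index, where none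
exists, if they differ. -/
lemma dvd_of_σ_pow_β_eq {i j : ι} (hi : i ∈ b.support) (hj : j ∈ b.support) {k : ℕ}
    (h : (c.σ ^ k) (c.β i) = c.β j) : n ∣ k := by
  have hpi := w.pos i hi
  have hpj := w.pos j hj
  have hdvd {m : ℕ} := coxeterSeq.two_mul_dvd (m := m) hn h₀ hpos
  have heven (m : ℕ) : ¬ 2 * n ∣ 2 * m + 1 := by
    rintro ⟨d, hd⟩
    rw [mul_assoc] at hd
    lia
  rcases mem₁_or_mem₂ (c := c) hi with hi' | hi' <;> rcases mem₁_or_mem₂ (c := c) hj with hj' | hj'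
  · obtain ⟨h₁, h₂⟩ := c.wt_σ_pow_β_of_mem₁ w hi' k
    rw [h, β_of_mem₁ hj', w.wt_root_of_notMem hj (notMem₂_of_mem₁ hj')] at h₁
    rw [h, β_of_mem₁ hj', w.wt_root_of_mem hj hj'] at h₂
    have hy : coxeterSeq w.μ (2 * k) = 0 := by simpa [hpi.ne'] using h₁.symm
    rw [hy, mul_zero, sub_zero] at h₂
    exact Nat.dvd_of_mul_dvd_mul_left two_pos
      (hdvd hy (pos_of_mul_pos_right (h₂ ▸ hpj) hpi.le))
  · obtain ⟨h₁, h₂⟩ := c.wt_σ_pow_β_of_mem₁ w hi' k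
    rw [h, β_of_mem₂ hj', map_neg, w.wt_root_of_mem hj hj'] at h₁
    rw [h, β_of_mem₂ hj', map_neg, w.wt_root_of_notMem hj (notMem₁_of_mem₂ hj')] at h₂
    obtain ⟨m, rfl⟩ : ∃ m, k = m + 1 := by
      refine ⟨k - 1, ?_⟩
      rcases Nat.eq_zero_or_pos k with rfl | hk
      · simp at h₁; linarith
      · lia
    have hy : 0 < coxeterSeq w.μ (2 * m + 2) := by
      refine pos_of_mul_pos_right (a := w.p i) ?_ hpi.le
      rw [show 2 * (m + 1) = 2 * m + 2 by ring] at h₁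
      linarith
    have hy' : coxeterSeq w.μ (2 * m + 1) = 0 := by
      rw [show 2 * (m + 1) = 2 * m + 1 + 1 by ring, coxeterSeq.add_two (2 * m + 1)] at h₂
      simpa [hpi.ne'] using h₂
    exact absurd (hdvd hy' hy) (heven m)
  · obtain ⟨h₁, h₂⟩ := c.wt_σ_pow_β_of_mem₂ w hi' k
    rw [h, β_of_mem₁ hj', w.wt_root_of_mem hj hj'] at h₁
    rw [h, β_of_mem₁ hj', w.wt_root_of_notMem hj (notMem₂_of_mem₁ hj')] at h₂
    have hy : coxeterSeq w.μ (2 * k + 1) = 0 := by simpa [hpi.ne'] using h₂.symm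
    refine absurd (hdvd hy ?_) (heven k)
    rw [coxeterSeq.add_two, hy, mul_zero, zero_sub]
    exact pos_of_mul_pos_right (a := w.p i) (by linarith) hpi.le
  · obtain ⟨h₁, h₂⟩ := c.wt_σ_pow_β_of_mem₂ w hi' k
    rw [h, β_of_mem₂ hj', map_neg, w.wt_root_of_notMem hj (notMem₁_of_mem₂ hj')] at h₁
    rw [h, β_of_mem₂ hj', map_neg, w.wt_root_of_mem hj hj'] at h₂
    have hy : coxeterSeq w.μ (2 * k) = 0 := by simpa [hpi.ne'] using h₁.symm
    exact Nat.dvd_of_mul_dvd_mul_left two_pos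
      (hdvd hy (pos_of_mul_pos_right (a := w.p i) (by linarith) hpi.le))

/-- No orbit of `σ` consists of positive roots: the sum over the orbit is fixed by `σ`, hence has
the same image under `τ₁` and `τ₂`, and if its weights are not both zero, this forces `w.μ = 2`, in
which case `coxeterSeq w.μ` does not return to zero. -/
lemma exists_σ_pow_notMem_posRoots [Finite ι] [P.IsCrystallographic] [P.IsReduced] (v : M) :
    ∃ k : ℕ, (c.σ ^ k) v ∉ b.posRoots := by
  by_contra! hv
  have hσ := c.σ_pow_eq_one w hn h₀ hpos
  let V : M := ∑ k ∈ Finset.range n, (c.σ ^ k) v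
  have hV : c.τ₁ V = c.τ₂ V := by
    have h : c.σ V = V := by
      have h₁ : ∑ k ∈ Finset.range (n + 1), (c.σ ^ k) v = V + v := by
        rw [Finset.sum_range_succ, hσ]
        rfl
      rw [Finset.sum_range_succ'] at h₁
      simp only [pow_succ', LinearEquiv.mul_apply, pow_zero, LinearEquiv.coe_one, id_eq,
        ← map_sum] at h₁
      exact add_right_cancel h₁
    rw [σ_apply] at h
    rw [← h, ← swap_τ₁, τ₁_τ₁_apply, swap_τ₁, h]
  have hV₀ : 0 < w.wt c.I₁ V + w.wt c.I₂ V := by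
    rw [map_sum, map_sum, ← Finset.sum_add_distrib]
    exact Finset.sum_pos (fun k _ ↦ w.wt_add_wt_pos c (hv k)) ⟨0, by simpa using hn⟩
  have h₁ := congrArg (w.wt c.I₁) hV
  have h₂ := congrArg (w.wt c.I₂) hV
  rw [w.wt₁_τ₁, wt₁_τ₂] at h₁
  rw [w.wt₂_τ₁, wt₂_τ₂] at h₂
  have hμ : w.μ = 2 := mul_right_cancel₀ hV₀.ne' (by linarith)
  rw [hμ, coxeterSeq.two_eq_natCast] at h₀
  exact hn.ne' (by exact_mod_cast h₀)

/-- An orbit of roots passes from a positive root `γ` to a negative root `σ γ`. If `τ₁ γ` is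
negative then `γ` is simple, and otherwise `-σ γ` is simple. -/
lemma exists_σ_pow_eq_β [Finite ι] [P.IsCrystallographic] [P.IsReduced] {v : M}
    (hv : v ∈ Set.range P.root) : ∃ i ∈ b.support, ∃ k : ℕ, (c.σ ^ k) v = c.β i := by
  classical
  obtain ⟨k₀, hk₀⟩ : ∃ k : ℕ, (c.σ ^ k) v ∈ b.posRoots := by
    obtain ⟨k, hk⟩ := c.exists_σ_pow_notMem_posRoots w hn h₀ hpos (-v)
    rw [map_neg] at hk
    exact ⟨k, (mem_posRoots_or_neg_mem (c.σ_pow_mem_range k hv)).resolve_right hk⟩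
  have hex := c.exists_σ_pow_notMem_posRoots w hn h₀ hpos ((c.σ ^ k₀) v)
  obtain ⟨l, hl⟩ : ∃ l, Nat.find hex = l + 1 := by
    refine Nat.exists_eq_succ_of_ne_zero fun h ↦ Nat.find_spec hex ?_
    simpa [h] using hk₀
  set γ : M := (c.σ ^ l) ((c.σ ^ k₀) v) with hγ
  have hγ' : γ = (c.σ ^ (l + k₀)) v := by rw [hγ, pow_add]; rfl
  have hγ₀ : γ ∈ b.posRoots := not_not.mp (Nat.find_min hex (by lia))
  have hγr := mem_range_of_mem_posRoots hγ₀
  have hσγ : c.σ γ ∉ b.posRoots := by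
    have := Nat.find_spec hex
    rwa [hl, pow_succ', LinearEquiv.mul_apply] at this
  by_cases hτ : c.τ₁ γ ∈ b.posRoots
  · have hneg : -c.τ₂ (c.τ₁ γ) ∈ b.posRoots := (mem_posRoots_or_neg_mem
      (c.τ₂_mem_range (c.τ₁_mem_range hγr))).resolve_left hσγ
    have h₁ := w.wt_nonneg c.I₁ hneg
    rw [map_neg, wt₁_τ₂] at h₁
    obtain ⟨i, hi, hi'⟩ := w.exists_eq_root_of_wt₂_eq_zero c.swap hτ
      (le_antisymm (by simpa using! h₁) (w.wt_nonneg _ hτ))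
    refine ⟨i, mem_support_of_mem₂ hi, l + k₀ + 1, ?_⟩
    rw [pow_succ', LinearEquiv.mul_apply, ← hγ', σ_apply, hi', β_of_mem₂ hi]
    exact c.swap.τ₁_root hi
  · have hneg := (mem_posRoots_or_neg_mem (c.τ₁_mem_range hγr)).resolve_left hτ
    have h₁ := w.wt_nonneg c.I₂ hneg
    rw [map_neg, w.wt₂_τ₁] at h₁
    obtain ⟨i, hi, hi'⟩ := w.exists_eq_root_of_wt₂_eq_zero c hγ₀
      (le_antisymm (by simpa using h₁) (w.wt_nonneg _ hγ₀))
    exact ⟨i, mem_support_of_mem₁ hi, l + k₀, by rw [← hγ', hi', β_of_mem₁ hi]⟩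

end Order

/-- The orbits of the bipartite Coxeter element through the modified simple roots have a common
size and form a partition of an irreducible reduced crystallographic root system. -/
theorem exists_ncard_orbit_eq [Finite ι] [Nonempty ι] [P.IsCrystallographic] [P.IsReduced]
    [P.IsIrreducible] :
    ∃ n, (∀ i ∈ b.support, (c.orbit i).Finite ∧ (c.orbit i).ncard = n) ∧
      Set.range P.root = (⋃ i ∈ b.support, c.orbit i) ∧
      (b.support : Set ι).PairwiseDisjoint c.orbit ∧ Nat.card ι = b.support.card * n := by
  obtain ⟨w⟩ := b.nonempty_perronVector
  obtain ⟨n, hn, h₀, hpos⟩ := c.exists_first_zero w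
  have hσ := c.σ_pow_eq_one w hn h₀ hpos
  have hdvd {i j : ι} (hi : i ∈ b.support) (hj : j ∈ b.support) {k l : ℕ} (hkl : k ≤ l)
      (h : (c.σ ^ l) (c.β i) = (c.σ ^ k) (c.β j)) : n ∣ l - k := by
    obtain ⟨d, rfl⟩ := Nat.exists_eq_add_of_le hkl
    rw [pow_add, LinearEquiv.mul_apply] at h
    simpa using c.dvd_of_σ_pow_β_eq w hn h₀ hpos hi hj ((c.σ ^ k).injective h)
  have hβ {i j : ι} (hi : i ∈ b.support) (hj : j ∈ b.support) (h : c.β i = c.β j) : i = j := by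
    by_contra hij
    unfold β at h
    have hne := b.root_ne_neg_of_ne hi hj hij
    split_ifs at h with h₁ h₂ h₂
    · exact hij (P.root.injective h)
    · exact hne h
    · exact hne (by rw [← h, neg_neg])
    · exact hij (P.root.injective (neg_injective h))
  have horbit (i) : c.orbit i = (fun k : ℕ ↦ (c.σ ^ k) (c.β i)) '' Finset.range n := by
    ext x
    rw [mem_orbit_iff hn hσ]
    constructor
    · rintro ⟨k, rfl⟩
      refine ⟨k % n, by simpa using Nat.mod_lt k hn, ?_⟩
      simp only
      rw [pow_eq_pow_mod k hσ]
    · rintro ⟨k, -, rfl⟩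
      exact ⟨k, rfl⟩
  have hfin (i) : (c.orbit i).Finite := by
    rw [horbit]
    exact (Finset.finite_toSet _).image _
  have hcard (i) (hi : i ∈ b.support) : (c.orbit i).ncard = n := by
    rw [horbit, Set.InjOn.ncard_image, Set.ncard_coe_finset, Finset.card_range]
    intro k hk l hl hkl
    simp only [Finset.coe_range, Set.mem_Iio] at hk hl
    rcases le_total k l with h | h
    · have := Nat.eq_zero_of_dvd_of_lt (hdvd hi hi h hkl.symm) (by lia)
      lia
    · have := Nat.eq_zero_of_dvd_of_lt (hdvd hi hi h hkl) (by lia)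
      lia
  have hunion : Set.range P.root = ⋃ i ∈ b.support, c.orbit i := by
    ext v
    simp only [Set.mem_iUnion, exists_prop, mem_orbit_iff hn hσ]
    constructor
    · intro hv
      obtain ⟨i, hi, k, hk⟩ := c.exists_σ_pow_eq_β w hn h₀ hpos hv
      obtain ⟨l, hl⟩ : ∃ l, n ∣ l + k := ⟨(n - 1) * k, k, by
        obtain ⟨m, rfl⟩ : ∃ m, n = m + 1 := ⟨n - 1, by lia⟩
        simp; ring⟩
      refine ⟨i, hi, l, ?_⟩
      obtain ⟨d, hd⟩ := hl
      rw [← hk, ← LinearEquiv.mul_apply, ← pow_add, hd, pow_mul, hσ, one_pow]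
      rfl
    · rintro ⟨i, -, k, rfl⟩
      exact c.σ_pow_mem_range k (c.β_mem_range i)
  have hdisj : (b.support : Set ι).PairwiseDisjoint c.orbit := by
    intro i hi j hj hij
    rw [Function.onFun, Set.disjoint_left]
    intro x hxi hxj
    rw [mem_orbit_iff hn hσ] at hxi hxj
    obtain ⟨k, rfl⟩ := hxi
    obtain ⟨l, hl⟩ := hxj
    wlog hkl : k ≤ l generalizing i j k l
    · exact this hj hi hij.symm l k hl.symm (by lia)
    obtain ⟨d, hd⟩ := hdvd hj hi hkl hl
    have : c.σ ^ l = c.σ ^ k := by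
      rw [show l = k + n * d by lia, pow_add, pow_mul, hσ, one_pow, mul_one]
    rw [this] at hl
    exact hij (hβ hi hj ((c.σ ^ k).injective hl).symm)
  refine ⟨n, fun i hi ↦ ⟨hfin i, hcard i hi⟩, hunion, hdisj, ?_⟩
  have : DecidableEq M := Classical.decEq M
  have hU : (⋃ i ∈ b.support, c.orbit i) =
      ((b.support.biUnion fun i ↦ (hfin i).toFinset : Finset M) : Set M) := by
    ext
    simp
  rw [← Set.ncard_univ, ← Set.ncard_image_of_injective _ P.root.injective, Set.image_univ, hunion,
    hU, Set.ncard_coe_finset, Finset.card_biUnion, Finset.sum_const_nat]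
  · intro i hi
    rw [← hcard i hi, Set.ncard_eq_toFinset_card _ (hfin i)]
  · intro i hi j hj hij
    simpa using hdisj hi hj hij

end RootPairing.Base.OrthogonalBipartition

/-! ### Simple Lie algebras -/

/-- The root space decomposition: the Cartan subalgebra is the weight space of zero, and the root
spaces have dimension one. -/
lemma LieAlgebra.IsKilling.finrank_eq_finrank_add_card_root {K L : Type*} [Field K] [CharZero K]
    [LieRing L] [LieAlgebra K L] [FiniteDimensional K L] [LieAlgebra.IsKilling K L]
    [Nontrivial L] (H : LieSubalgebra K L) [H.IsCartanSubalgebra]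
    [LieModule.IsTriangularizable K H L] :
    Module.finrank K L = Module.finrank K H + H.root.card := by
  classical
  let A : LieModule.Weight K H L → Submodule K L := fun χ ↦ (LieAlgebra.rootSpace H χ).toSubmodule
  have hind : iSupIndep A := LieSubmodule.iSupIndep_toSubmodule.mpr
    (LieModule.iSupIndep_genWeightSpace' K H L)
  have htop : iSup A = ⊤ := by
    rw [← LieSubmodule.iSup_toSubmodule, LieModule.iSup_genWeightSpace_eq_top' K H L]
    rfl
  have hint := DirectSum.isInternal_submodule_of_iSupIndep_of_iSup_eq_top hind htop
  have hsum : Module.finrank K L = ∑ χ, Module.finrank K (A χ) := by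
    rw [← (LinearEquiv.ofBijective (DirectSum.coeLinearMap A) hint).finrank_eq,
      Module.finrank_directSum]
  have hzero : Module.finrank K (A 0) = Module.finrank K H := by
    have h : A 0 = H.toSubmodule :=
      congrArg LieSubmodule.toSubmodule (LieAlgebra.rootSpace_zero_eq K L H)
    rw [h]
    rfl
  rw [hsum, ← Finset.add_sum_erase _ _ (Finset.mem_univ (0 : LieModule.Weight K H L)), hzero]
  congr 1
  have hroot : Finset.univ.erase (0 : LieModule.Weight K H L) = H.root := by
    ext χ
    simp [LieModule.Weight.IsNonZero, LieModule.Weight.isZero_iff_eq_zero]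
  rw [hroot, Finset.card_eq_sum_ones]
  exact Finset.sum_congr rfl fun χ hχ ↦
    LieAlgebra.IsKilling.finrank_rootSpace_eq_one χ (by simpa using hχ)

theorem theorem1p8 {𝔤 : Type*} [LieRing 𝔤] [LieAlgebra ℂ 𝔤] [FiniteDimensional ℂ 𝔤]
    [LieAlgebra.IsSimple ℂ 𝔤] (H : LieSubalgebra ℂ 𝔤) [H.IsCartanSubalgebra]
    [DecidableEq H.root]
    (b : (LieAlgebra.IsKilling.rootSystem H).Base) (c : b.OrthogonalBipartition) :
    b.support.card = Module.finrank ℂ H ∧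
    Module.finrank ℂ 𝔤 = Module.finrank ℂ H * (LieAlgebra.coxeterNumber H + 1) ∧
    (∀ i ∈ b.support, (c.orbit i).Finite ∧ (c.orbit i).ncard = LieAlgebra.coxeterNumber H) ∧
    Set.range (LieAlgebra.IsKilling.rootSystem H).root = (⋃ i ∈ b.support, c.orbit i) ∧
    (b.support : Set H.root).PairwiseDisjoint c.orbit := by
  have hrank : b.support.card = Module.finrank ℂ H := by
    rw [← Subspace.dual_finrank_eq, Module.finrank_eq_card_basis b.toWeightBasis, Fintype.card_coe]
  have := LieAlgebra.IsSimple.nontrivial ℂ 𝔤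
  have hM : Nontrivial (Module.Dual ℂ H) :=
    RootPairing.IsIrreducible.nontrivial (P := LieAlgebra.IsKilling.rootSystem H)
  have : Nonempty H.root := by
    by_contra hempty
    rw [not_nonempty_iff] at hempty
    have h := RootPairing.IsRootSystem.span_root_eq_top (P := LieAlgebra.IsKilling.rootSystem H)
    rw [Set.range_eq_empty, Submodule.span_empty] at h
    exact bot_ne_top h
  obtain ⟨n, horbit, hunion, hdisj, hcard⟩ := c.exists_ncard_orbit_eq
  have hpos : 0 < Module.finrank ℂ H := hrank ▸ b.support_nonempty.card_pos
  have hdim : Module.finrank ℂ 𝔤 = Module.finrank ℂ H * (n + 1) := by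
    rw [LieAlgebra.IsKilling.finrank_eq_finrank_add_card_root H, mul_add, mul_one, add_comm,
      ← hrank, ← hcard, Nat.card_eq_fintype_card, Fintype.card_coe]
  have hn : LieAlgebra.coxeterNumber H = n := by
    rw [LieAlgebra.coxeterNumber, hdim, Nat.mul_div_cancel_left _ hpos, Nat.add_sub_cancel]
  rw [hn]
  exact ⟨hrank, hdim, horbit, hunion, hdisj⟩
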